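/- Let $G$ be a finite connected simple graph. $G$ is chordal if it contains no induced cycle of length greater than $3$. For integers $\mu, c \ge 0$, a system of at most $\mu$ spanning trees of $G$ collectively $+c$-spans $G$ if for every two vertices $u, v$ of $G$ there is a tree $T$ in the system with $\mathrm{dist}_T(u,v) \le \mathrm{dist}_G(u,v) + c$. Theorem. No constant number of spanning trees can collectively $+3$-span chordal graphs; that is, for every integer $\mu \ge 0$ there exists a finite connected chordal graph $G$ such that no system of at most $\mu$ spanning trees of $G$ collectively $+3$-spans $G$. -/

import Mathlib

namespace CollectiveTreeSpanners

/-- A graph is chordal if it contains no induced cycle of length greater than 3. -/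
def IsChordal {V : Type*} (G : SimpleGraph V) : Prop :=
  ∀ k : ℕ, 3 < k → ¬ (SimpleGraph.cycleGraph k).IsIndContained G

/-- `T` is a spanning tree of `G`: a subgraph of `G` on the same vertex set that is a tree. -/
def IsSpanningTree {V : Type*} (T G : SimpleGraph V) : Prop :=
  T ≤ G ∧ T.IsTree

/-- The system `𝒯` of spanning trees of `G` collectively `+c`-spans `G`: for any two vertices
some tree of the system preserves their distance up to the additive surplus `c`. -/
def CollectivelySpans {V : Type*} (𝒯 : Finset (SimpleGraph V)) (c : ℕ) (G : SimpleGraph V) : Prop :=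
  (∀ T ∈ 𝒯, IsSpanningTree T G) ∧
    ∀ u v : V, ∃ T ∈ 𝒯, T.dist u v ≤ G.dist u v + c

/-- `G` admits a system of (at most) `μ` collective additive tree `c`-spanners. -/
def AdmitsCollectiveTreeSpanners {V : Type*} (G : SimpleGraph V) (μ c : ℕ) : Prop :=
  ∃ 𝒯 : Finset (SimpleGraph V), 𝒯.card ≤ μ ∧ CollectivelySpans 𝒯 c G

end CollectiveTreeSpanners

namespace CollectiveTreeSpanners

/-! Take a large finite stage of a graph in which every nonempty clique later gets a vertex attached
to exactly that clique. Given at most `μ` trees, keep a vertex `p` and a set `S` of trees that are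
exact from `p` to the early vertices hanging at `p`.

A tree in `S` enters such a vertex from a parent one level lower. Attaching vertices one at a time
and discarding the parents already used keeps these parents distinct. So three levels above `p`
there are adjacent `x`, `q` in different branches at `p` of every tree in `S`, at tree distance at
least 6 (`exists_clique_branches`, `le_dist_of_branches`).

Next fix `x` and move `q`. Since `q` is a cut vertex, passing to some `b` hanging at `q` adds at
least the error of a tree on `q`, `b` to its error on `x`, `q`. Either boundedly many moves make
every error exceed 3, or a new tree is exact above the current `q` and joins `S`
(`exists_defeats_of_excess`). The latter happens at most `μ` times (`exists_defeats`). -/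

/-- A finite stage of the universal chordal graph: every vertex is attached to a clique `par v` of
vertices of smaller birth, and every nonempty clique of early birth is `par v` for some vertex `v`.
The `level` is the distance to the root. -/
structure CliqueTower (V : Type) (N : ℕ) where
  graph : SimpleGraph V
  par : V → Finset V
  birth : V → ℕ
  level : V → ℕ
  root : V
  birth_root : birth root = 0
  connected : graph.Connected
  adj_iff : ∀ u v, graph.Adj u v ↔ u ∈ par v ∨ v ∈ par u
  birth_lt : ∀ u v, u ∈ par v → birth u < birth v
  isClique_par : ∀ v, graph.IsClique (par v : Set V)
  exists_level : ∀ v, (par v).Nonempty → ∃ u ∈ par v, level v = level u + 1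
  level_le : ∀ u v, u ∈ par v → level v ≤ level u + 1
  exists_par : ∀ (m : ℕ) (Q : Finset V), Q.Nonempty → graph.IsClique (Q : Set V) →
    (∀ u ∈ Q, birth u < m) → 2 ^ m ≤ N → ∃ v, par v = Q ∧ birth v < 2 ^ m

/-! ### Levels and parents -/

namespace CliqueTower

variable {V : Type} {N : ℕ} (X : CliqueTower V N)

lemma adj_of_mem {u v : V} (h : u ∈ X.par v) : X.graph.Adj u v := (X.adj_iff u v).2 (Or.inl h)

/-- Compare `u` with a parent `z` of `v` one level below `v`. They are adjacent: if `u` is a parent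
of `z`, induct on birth; if `z` is a parent of `u`, then `u` is at most one level above `z`. -/
lemma level_mono {u v : V} (h : u ∈ X.par v) : X.level u ≤ X.level v := by
  induction hn : X.birth v using Nat.strong_induction_on generalizing u v with
  | _ n ih =>
    obtain ⟨z, hz, hL⟩ := X.exists_level v ⟨u, h⟩
    by_cases huz : u = z
    · subst huz; omega
    · rcases (X.adj_iff u z).1 (X.isClique_par v h hz huz) with h1 | h1
      · have := ih _ (hn ▸ X.birth_lt _ _ hz) h1 rfl
        omega
      · have := X.level_le _ _ h1
        omega

lemma level_le_of_adj {u v : V} (h : X.graph.Adj u v) : X.level v ≤ X.level u + 1 := by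
  rcases (X.adj_iff u v).1 h with h | h
  · exact X.level_le _ _ h
  · exact (X.level_mono h).trans (Nat.le_succ _)

lemma mem_par_of_adj_of_level_lt {u v : V} (h : X.graph.Adj u v) (hl : X.level u < X.level v) :
    u ∈ X.par v := by
  rcases (X.adj_iff u v).1 h with h | h
  · exact h
  · exact absurd (X.level_mono h) (by omega)

lemma level_le_add_length {u v : V} (w : X.graph.Walk u v) :
    X.level v ≤ X.level u + w.length := by
  induction w with
  | nil => simp
  | cons h w ih =>
    have := X.level_le_of_adj h
    rw [SimpleGraph.Walk.length_cons]
    omega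

lemma level_le_add_dist {T : SimpleGraph V} (hT : T ≤ X.graph) (hc : T.Connected) (u v : V) :
    X.level v ≤ X.level u + T.dist u v := by
  obtain ⟨w, hw⟩ := hc.exists_walk_length_eq_dist u v
  have := X.level_le_add_length (w.mapLe hT)
  simpa [hw] using this

/-- A geodesic of a subgraph along which the level increases by one in each step enters its
endpoint from a vertex the endpoint was attached to. -/
lemma exists_parent {T : SimpleGraph V} (hT : T ≤ X.graph) (hc : T.Connected) {p v : V} {h : ℕ}
    (hd : T.dist p v ≤ h + 1) (hl : X.level v = X.level p + (h + 1)) :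
    ∃ u ∈ X.par v, T.Adj u v ∧ X.level u = X.level p + h := by
  obtain ⟨w, hw⟩ := hc.exists_walk_length_eq_dist v p
  rw [T.dist_comm] at hw
  cases w with
  | nil => omega
  | @cons _ u _ hvu w =>
    rw [SimpleGraph.Walk.length_cons] at hw
    have h1 := X.level_le_add_dist hT hc p u
    have h2 := SimpleGraph.dist_le w
    rw [T.dist_comm] at h2
    have h3 := X.level_le_of_adj (hT hvu.symm)
    exact ⟨u, X.mem_par_of_adj_of_level_lt (hT hvu.symm) (by omega), hvu.symm, by omega⟩

/-! ### Cut vertices -/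

/-- `X.Desc p v`: the vertex `v` hangs at the cut vertex `p`. -/
inductive Desc (p : V) : V → Prop
  | intro (v : V) : (X.par v).Nonempty → (∀ u ∈ X.par v, u ≠ p → Desc p u) → Desc p v

variable {X}

lemma Desc.of_par {p v : V} (hne : (X.par v).Nonempty) (h : ∀ u ∈ X.par v, u = p ∨ X.Desc p u) :
    X.Desc p v :=
  .intro v hne fun u hu => (h u hu).resolve_left

lemma Desc.mem_par {p u v : V} (h : X.Desc p v) (hu : u ∈ X.par v) : u = p ∨ X.Desc p u := by
  cases h with
  | intro _ _ h => exact or_iff_not_imp_left.2 (h u hu)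

lemma Desc.level_lt {p v : V} (h : X.Desc p v) : X.level p < X.level v := by
  induction h with
  | intro v hne _ ih =>
    obtain ⟨u, hu, hL⟩ := X.exists_level v hne
    by_cases hup : u = p
    · subst hup; omega
    · have := ih u hu hup
      omega

lemma Desc.trans {p q v : V} (hq : X.Desc p q) (h : X.Desc q v) : X.Desc p v := by
  induction h with
  | intro v hne _ ih =>
    refine .of_par hne fun u hu => ?_
    by_cases huq : u = q
    · exact Or.inr (huq ▸ hq)
    · exact Or.inr (ih u hu huq)

/-- Any other `z` in the clique is adjacent to `b`: either it is a parent of `b`, or `b` is a parent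
of `z` and induction on birth applies. -/
lemma Desc.mem_par_of_mem_par {q b c : V} (hb : X.Desc q b) (h : b ∈ X.par c) :
    ∀ z ∈ X.par c, z = q ∨ X.Desc q z := by
  induction hn : X.birth c using Nat.strong_induction_on generalizing c with
  | _ n ih =>
    intro z hz
    by_cases hzb : z = b
    · exact Or.inr (hzb ▸ hb)
    · rcases (X.adj_iff z b).1 (X.isClique_par c hz h hzb) with h1 | h1
      · exact hb.mem_par h1
      · exact Or.inr (Desc.of_par ⟨b, h1⟩ (ih _ (hn ▸ X.birth_lt _ _ hz) h1 rfl))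

lemma Desc.adj {q b c : V} (hb : X.Desc q b) (h : X.graph.Adj b c) : c = q ∨ X.Desc q c := by
  rcases (X.adj_iff b c).1 h with h | h
  · exact Or.inr (Desc.of_par ⟨b, h⟩ (hb.mem_par_of_mem_par h))
  · exact hb.mem_par h

lemma Desc.mem_support {T : SimpleGraph V} (hT : T ≤ X.graph) {q b x : V} (hb : X.Desc q b)
    (hx : ¬ X.Desc q x) (w : T.Walk b x) : q ∈ w.support := by
  induction w with
  | nil => exact absurd hb hx
  | @cons _ c _ h w ih =>
    rw [SimpleGraph.Walk.support_cons]
    rcases hb.adj (hT h) with rfl | h1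
    · exact List.mem_cons_of_mem _ w.start_mem_support
    · exact List.mem_cons_of_mem _ (ih h1 hx)

end CliqueTower

/-! ### Branches and exact trees -/

lemma dist_add_dist_le_length {V : Type} {T : SimpleGraph V} {a b p : V} (w : T.Walk a b)
    (hp : p ∈ w.support) : T.dist a p + T.dist p b ≤ w.length := by
  classical
  rw [← congrArg SimpleGraph.Walk.length (w.take_spec hp), SimpleGraph.Walk.length_append]
  exact add_le_add (SimpleGraph.dist_le _) (SimpleGraph.dist_le _)

/-- In an acyclic graph every walk between two different neighbours of `p` passes through `p`. -/
lemma mem_support_of_adj_of_adj {V : Type} {T : SimpleGraph V} (hT : T.IsAcyclic) {p k l : V}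
    (hk : T.Adj p k) (hl : T.Adj p l) (hkl : k ≠ l) (w : T.Walk k l) : p ∈ w.support := by
  classical
  have hq : (SimpleGraph.Walk.cons hk.symm (.cons hl .nil)).IsPath := by
    simp [hkl, hk.ne', hl.ne]
  have := (hT.subsingleton_path k l).elim w.toPath ⟨_, hq⟩
  apply w.support_toPath_subset_support
  rw [this]
  simp

namespace CliqueTower
variable {V : Type} {N : ℕ} {X : CliqueTower V N}

lemma Desc.dist_add_dist_le {T : SimpleGraph V} (hT : T ≤ X.graph) (hc : T.Connected) {q b x : V}
    (hb : X.Desc q b) (hx : ¬ X.Desc q x) : T.dist x q + T.dist q b ≤ T.dist x b := by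
  obtain ⟨w, hw⟩ := hc.exists_walk_length_eq_dist b x
  have := dist_add_dist_le_length w (hb.mem_support hT hx w)
  rw [T.dist_comm (u := b) (v := q), T.dist_comm (u := q) (v := x)] at this
  rw [T.dist_comm (u := x) (v := b)]
  omega

/-- By levels, `a` and `b` are at distance at least `h + 1` from `p`, so the short walks from `k`
and `l` avoid `p`. The closed-up walk `k`, `a`, `b`, `l` must meet `p`, hence does so between `a`
and `b`. -/
lemma le_dist_of_branches {T : SimpleGraph V} (hT : T ≤ X.graph) (ht : T.IsTree)
    {p a b k l : V} {h : ℕ} (ha : X.level a = X.level p + (h + 1))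
    (hb : X.level b = X.level p + (h + 1)) (hk : T.Adj p k) (hl : T.Adj p l) (hkl : k ≠ l)
    (hka : T.dist k a ≤ h) (hlb : T.dist l b ≤ h) : 2 * (h + 1) ≤ T.dist a b := by
  have hc := ht.1
  have la := X.level_le_add_dist hT hc p a
  have lb := X.level_le_add_dist hT hc p b
  have avoid : ∀ {c j : V} (w : T.Walk j c), h + 1 ≤ T.dist p c → w.length ≤ h →
      p ∉ w.support := fun w h1 h2 hp => by
    have := dist_add_dist_le_length w hp
    omega
  obtain ⟨wa, hwa⟩ := hc.exists_walk_length_eq_dist k a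
  obtain ⟨wb, hwb⟩ := hc.exists_walk_length_eq_dist l b
  obtain ⟨w, hw⟩ := hc.exists_walk_length_eq_dist a b
  have hp := mem_support_of_adj_of_adj ht.2 hk hl hkl ((wa.append w).append wb.reverse)
  simp only [SimpleGraph.Walk.mem_support_append_iff, SimpleGraph.Walk.support_reverse,
    List.mem_reverse] at hp
  have hpw : p ∈ w.support := by
    rcases hp with (hp | hp) | hp
    · exact absurd hp (avoid wa (by omega) (by omega))
    · exact hp
    · exact absurd hp (avoid wb (by omega) (by omega))
  have := dist_add_dist_le_length w hpw
  rw [T.dist_comm (u := a)] at this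
  omega

/-- Up to birth `M`, the distances from `p` to the vertices hanging at `p` are the same in `T`. -/
def Uprooted (X : CliqueTower V N) (T : SimpleGraph V) (p : V) (M : ℕ) : Prop :=
  ∀ b, X.Desc p b → X.birth b < M → T.dist p b ≤ X.graph.dist p b

lemma Uprooted.mono {T : SimpleGraph V} {p : V} {M M' : ℕ} (h : X.Uprooted T p M) (hM : M' ≤ M) :
    X.Uprooted T p M' := fun b hb hbM => h b hb (hbM.trans_le hM)

/-- In `T`, distances from `p` to `b` split exactly at the cut vertex `q`, so an error from `q`
would be an error from `p`. -/
lemma Uprooted.desc {T : SimpleGraph V} (hT : T ≤ X.graph) (hc : T.Connected) {p q : V} {M : ℕ}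
    (h : X.Uprooted T p M) (hq : X.Desc p q) : X.Uprooted T q M := fun b hb hbM => by
  have h1 := h b (hq.trans hb) hbM
  have h2 := hb.dist_add_dist_le hT hc (x := p) fun hp => by
    have := hp.level_lt
    have := hq.level_lt
    omega
  have h3 := X.connected.dist_triangle (u := p) (v := q) (w := b)
  have h4 := SimpleGraph.Reachable.dist_anti hT (hc.preconnected p q)
  omega

end CliqueTower
end CollectiveTreeSpanners
-- Cliques meeting many branches
namespace CollectiveTreeSpanners
namespace CliqueTower
variable {V : Type} {N : ℕ}

open scoped Classical in
lemma exists_clique_level_one (m n : ℕ) : ∃ M, m ≤ M ∧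
    ∀ {V : Type} {N : ℕ} (X : CliqueTower V N) (p : V), M ≤ N → X.birth p < m →
      ∃ A : Finset V, A.card = n ∧ X.graph.IsClique (insert p A : Set V) ∧
        ∀ a ∈ A, X.Desc p a ∧ X.birth a < M ∧ X.level a = X.level p + 1 := by
  induction n with
  | zero => exact ⟨m, le_rfl, fun X p _ _ => ⟨∅, by simp⟩⟩
  | succ n ih =>
    obtain ⟨M, hmM, hM⟩ := ih
    have hlt : M < 2 ^ M := Nat.lt_two_pow_self
    refine ⟨2 ^ M, by omega, fun {V N} X p hN hp => ?_⟩
    obtain ⟨A, hcard, hA, hprop⟩ := hM X p (by omega) hp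
    obtain ⟨a, hpar, hbirth⟩ := X.exists_par M (insert p A) (by simp) (by simpa using hA) (by
      intro u hu
      rcases Finset.mem_insert.1 hu with rfl | hu
      · omega
      · exact (hprop u hu).2.1) hN
    have hpa : p ∈ X.par a := by simp [hpar]
    have hadj : ∀ u ∈ insert p A, X.graph.Adj a u := fun u hu =>
      (X.adj_of_mem (hpar ▸ hu)).symm
    have haA : a ∉ A := fun h => X.graph.irrefl (hadj a (by simp [h]))
    have hdesc : X.Desc p a := Desc.of_par ⟨p, hpa⟩ fun u hu => by
      rw [hpar, Finset.mem_insert] at hu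
      exact hu.imp_right fun h => (hprop u h).1
    refine ⟨insert a A, by simp [haA, hcard], ?_, ?_⟩
    · rw [Finset.coe_insert, Set.insert_comm]
      exact hA.insert fun b hb _ => hadj b (by simpa using hb)
    · intro b hb
      rcases Finset.mem_insert.1 hb with rfl | hb
      · exact ⟨hdesc, hbirth, le_antisymm (X.level_le _ _ hpa) hdesc.level_lt⟩
      · exact ⟨(hprop b hb).1, (hprop b hb).2.1.trans hlt, (hprop b hb).2.2⟩

open scoped Classical in
/-- Over a large clique `C` one finds a clique of the next level whose members have, in each of at
most `μ` uprooted trees, pairwise different parents in `C`. -/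
lemma exists_clique_next_level (μ h m n : ℕ) : ∃ M, m ≤ M ∧
    ∀ {V : Type} {N : ℕ} (X : CliqueTower V N) (p : V) (S : Finset (SimpleGraph V)) (C : Finset V),
      M ≤ N → S.card ≤ μ → (∀ T ∈ S, IsSpanningTree T X.graph) →
      (∀ T ∈ S, X.Uprooted T p M) → X.graph.IsClique (C : Set V) → μ * n < C.card →
      (∀ c ∈ C, X.Desc p c ∧ X.birth c < m ∧ X.level c = X.level p + h ∧
        X.graph.dist p c ≤ h) →
      ∃ A R : Finset V, A.card = n ∧ R ⊆ C ∧ C.card ≤ R.card + μ * n ∧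
        X.graph.IsClique ((A ∪ R : Finset V) : Set V) ∧
        (∀ a ∈ A, X.Desc p a ∧ X.birth a < M ∧ X.level a = X.level p + (h + 1) ∧
          X.graph.dist p a ≤ h + 1) ∧
        ∀ T ∈ S, ∃ f : V → V, Set.InjOn f A ∧ ∀ a ∈ A, f a ∈ C \ R ∧ T.Adj (f a) a := by
  induction n with
  | zero =>
    refine ⟨m, le_rfl, fun X p S C _ _ _ _ hC _ _ =>
      ⟨∅, C, rfl, subset_rfl, by simp, by simpa using hC, by simp, fun T _ => ⟨id, by simp⟩⟩⟩
  | succ n ih =>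
    obtain ⟨M, hmM, hM⟩ := ih
    have hlt : M < 2 ^ M := Nat.lt_two_pow_self
    refine ⟨2 ^ M, by omega, fun {V N} X p S C hN hS hST hSU hC hCcard hCprop => ?_⟩
    rw [mul_add, mul_one] at hCcard
    obtain ⟨A, R, hA, hRC, hRcard, hclique, hAprop, hf⟩ := hM X p S C (by omega) hS hST
      (fun T hT => (hSU T hT).mono hlt.le) hC (by omega) hCprop
    have hRne : R.Nonempty := by rw [← Finset.card_pos]; omega
    have hdescU : ∀ u ∈ A ∪ R, X.Desc p u ∧ X.birth u < M := fun u hu => by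
      rcases Finset.mem_union.1 hu with hu | hu
      · exact ⟨(hAprop u hu).1, (hAprop u hu).2.1⟩
      · exact ⟨(hCprop u (hRC hu)).1, (hCprop u (hRC hu)).2.1.trans_le hmM⟩
    obtain ⟨a, hpar, hbirth⟩ := X.exists_par M (A ∪ R) (hRne.mono Finset.subset_union_right)
      hclique (fun u hu => (hdescU u hu).2) hN
    have hadj : ∀ u ∈ A ∪ R, X.graph.Adj a u := fun u hu => (X.adj_of_mem (hpar ▸ hu)).symm
    have haA : a ∉ A := fun h => X.graph.irrefl (hadj a (by simp [h]))
    obtain ⟨r, hr⟩ := hRne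
    have hrpar : r ∈ X.par a := by simp [hpar, hr]
    have hdesc : X.Desc p a := Desc.of_par ⟨r, hrpar⟩ fun u hu =>
      Or.inr (hdescU u (hpar ▸ hu)).1
    have hlevel : X.level a = X.level p + (h + 1) := by
      have h1 := X.level_le _ _ hrpar
      have h2 := (hCprop r (hRC hr)).2.2.1
      obtain ⟨z, hz, hzL⟩ := X.exists_level a ⟨r, hrpar⟩
      rw [hpar, Finset.mem_union] at hz
      rcases hz with hz | hz
      · have := (hAprop z hz).2.2.1
        omega
      · have := (hCprop z (hRC hz)).2.2.1
        omega
    have hdist : X.graph.dist p a ≤ h + 1 := by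
      have h1 := (hCprop r (hRC hr)).2.2.2
      have h2 := SimpleGraph.dist_eq_one_iff_adj.2 (X.adj_of_mem hrpar)
      have h3 := X.connected.dist_triangle (u := p) (v := r) (w := a)
      omega
    -- The members of `A` are on the level of `a`, so the parent of `a` in each tree lies in `R`.
    have hpt : ∀ T : SimpleGraph V, ∃ u, T ∈ S → u ∈ R ∧ T.Adj u a := fun T => by
      by_cases hT : T ∈ S
      · obtain ⟨u, hu, hua, huL⟩ := X.exists_parent (hST T hT).1 (hST T hT).2.1
          ((hSU T hT a hdesc hbirth).trans hdist) hlevel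
        refine ⟨u, fun _ => ⟨?_, hua⟩⟩
        rw [hpar, Finset.mem_union] at hu
        refine hu.resolve_left fun h => ?_
        have := (hAprop u h).2.2.1
        omega
      · exact ⟨p, fun h => absurd h hT⟩
    choose g hg using hpt
    -- Deleting the parents just used costs at most `μ` elements of `R` and keeps later parents
    -- different from them.
    refine ⟨insert a A, R \ S.image g, by simp [haA, hA], Finset.sdiff_subset.trans hRC, ?_, ?_, ?_,
      fun T hT => ?_⟩
    · have h1 := Finset.le_card_sdiff (S.image g) R
      have h2 : (S.image g).card ≤ S.card := Finset.card_image_le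
      rw [mul_add, mul_one]
      omega
    · have : X.graph.IsClique ((insert a (A ∪ R) : Finset V) : Set V) := by
        rw [Finset.coe_insert]
        exact hclique.insert fun b hb _ => hadj b hb
      refine this.subset ?_
      rw [Finset.coe_subset, Finset.insert_union]
      exact Finset.insert_subset_insert _
        (Finset.union_subset_union_right Finset.sdiff_subset)
    · intro b hb
      rcases Finset.mem_insert.1 hb with rfl | hb
      · exact ⟨hdesc, hbirth, hlevel, hdist⟩
      · obtain ⟨h1, h2, h3⟩ := hAprop b hb
        exact ⟨h1, h2.trans hlt, h3⟩
    · obtain ⟨f, hinj, hfA⟩ := hf T hT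
      obtain ⟨hgR, hga⟩ := hg T hT
      have hfa : ∀ b ∈ A, Function.update f a (g T) b = f b := fun b hb =>
        Function.update_of_ne (ne_of_mem_of_not_mem hb haA) _ _
      refine ⟨Function.update f a (g T), ?_, ?_⟩
      · rw [Finset.coe_insert, Set.injOn_insert (by simpa using haA)]
        refine ⟨fun b hb c hc hbc => hinj hb hc (by rwa [hfa b hb, hfa c hc] at hbc), ?_⟩
        rintro ⟨b, hb, hbg⟩
        rw [hfa b hb, Function.update_self] at hbg
        exact (Finset.mem_sdiff.1 (hfA b hb).1).2 (hbg ▸ hgR)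
      · intro b hb
        rcases Finset.mem_insert.1 hb with rfl | hb
        · rw [Function.update_self]
          refine ⟨?_, hga⟩
          simp only [Finset.mem_sdiff, hRC hgR, true_and, not_and, not_not]
          exact fun _ => Finset.mem_image_of_mem _ hT
        · rw [hfa b hb]
          refine ⟨?_, (hfA b hb).2⟩
          have := Finset.mem_sdiff.1 (hfA b hb).1
          simp [this.1, this.2]

open scoped Classical in
/-- Above `p` there is a clique of any size, on any positive level, whose members lie in pairwise
different branches at `p` of each of at most `μ` uprooted trees. -/
lemma exists_clique_branches (μ h m n : ℕ) : ∃ M, m ≤ M ∧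
    ∀ {V : Type} {N : ℕ} (X : CliqueTower V N) (p : V) (S : Finset (SimpleGraph V)),
      M ≤ N → X.birth p < m → S.card ≤ μ → (∀ T ∈ S, IsSpanningTree T X.graph) →
      (∀ T ∈ S, X.Uprooted T p M) →
      ∃ A : Finset V, A.card = n ∧ X.graph.IsClique (A : Set V) ∧
        (∀ a ∈ A, X.Desc p a ∧ X.birth a < M ∧ X.level a = X.level p + (h + 1) ∧
          X.graph.dist p a ≤ h + 1) ∧
        ∀ T ∈ S, ∃ k : V → V, Set.InjOn k A ∧ ∀ a ∈ A, T.Adj p (k a) ∧ T.dist (k a) a ≤ h := by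
  induction h generalizing n with
  | zero =>
    obtain ⟨M, hmM, hM⟩ := exists_clique_level_one m n
    refine ⟨M, hmM, fun {V N} X p S hN hp hS hST hSU => ?_⟩
    obtain ⟨A, hA, hclique, hprop⟩ := hM X p hN hp
    have hadj : ∀ a ∈ A, X.graph.Adj p a := fun a ha => by
      refine hclique (by simp) (by simp [ha]) ?_
      rintro rfl
      exact (hprop p ha).1.level_lt.false
    have hdist : ∀ a ∈ A, X.graph.dist p a ≤ 1 := fun a ha =>
      (SimpleGraph.dist_eq_one_iff_adj.2 (hadj a ha)).le
    refine ⟨A, hA, hclique.subset (Set.subset_insert _ _), fun a ha => ?_, fun T hT =>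
      ⟨id, Function.injective_id.injOn, fun a ha => ⟨?_, by simp⟩⟩⟩
    · obtain ⟨h1, h2, h3⟩ := hprop a ha
      exact ⟨h1, h2, h3, hdist a ha⟩
    · obtain ⟨h1, h2, -⟩ := hprop a ha
      have h3 := (hSU T hT a h1 h2).trans (hdist a ha)
      have h4 := (hST T hT).2.1.pos_dist_of_ne (hadj a ha).ne
      exact SimpleGraph.dist_eq_one_iff_adj.1 (by simp only [id]; omega)
  | succ h ih =>
    obtain ⟨M₁, hmM₁, hM₁⟩ := ih (μ * n + 1)
    obtain ⟨M, hMM, hM⟩ := exists_clique_next_level μ (h + 1) M₁ n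
    refine ⟨M, by omega, fun {V N} X p S hN hp hS hST hSU => ?_⟩
    obtain ⟨C, hC, hCclique, hCprop, hCk⟩ := hM₁ X p S (by omega) hp hS hST
      (fun T hT => (hSU T hT).mono hMM)
    obtain ⟨A, R, hA, -, -, hclique, hprop, hf⟩ := hM X p S C hN hS hST hSU hCclique (by omega)
      hCprop
    refine ⟨A, hA, hclique.subset (by simp), hprop, fun T hT => ?_⟩
    obtain ⟨k, hk, hkC⟩ := hCk T hT
    obtain ⟨f, hfinj, hfA⟩ := hf T hT
    have hfC : ∀ a ∈ A, f a ∈ C := fun a ha => (Finset.mem_sdiff.1 (hfA a ha).1).1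
    refine ⟨k ∘ f, hk.comp hfinj hfC, fun a ha => ⟨(hkC _ (hfC a ha)).1, ?_⟩⟩
    have h1 := (hkC _ (hfC a ha)).2
    have h2 := SimpleGraph.dist_eq_one_iff_adj.2 (hfA a ha).2
    have h3 := (hST T hT).2.1.dist_triangle (u := k (f a)) (v := f a) (w := a)
    simp only [Function.comp]
    omega

/-! ### Accumulating the stretch -/

/-- Some pair of vertices is stretched by more than `3` in every tree of the system. -/
def Defeats (X : CliqueTower V N) (𝒯 : Finset (SimpleGraph V)) : Prop :=
  ∃ x y, ∀ T ∈ 𝒯, X.graph.dist x y + 3 < T.dist x y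

open scoped Classical in
/-- If no tree outside `S` may be made uprooted without losing, a pair `x`, `q` can be prolonged
at `q` until every tree stretches it by more than `3`. -/
lemma exists_defeats_of_excess {μ : ℕ} (k : ℕ)
    (ih : ∀ m, ∃ M, m ≤ M ∧ ∀ {V : Type} {N : ℕ} (X : CliqueTower V N)
      (𝒯 S : Finset (SimpleGraph V)) (p : V), M ≤ N → (∀ T ∈ 𝒯, IsSpanningTree T X.graph) →
      S ⊆ 𝒯 → (𝒯 \ S).card < k → X.birth p < m → (∀ T ∈ S, X.Uprooted T p M) → 𝒯.card ≤ μ →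
      X.Defeats 𝒯) (j m : ℕ) :
    ∃ M, m ≤ M ∧ ∀ {V : Type} {N : ℕ} (X : CliqueTower V N) (𝒯 S : Finset (SimpleGraph V))
      (x q : V) (need : SimpleGraph V → ℕ), M ≤ N → (∀ T ∈ 𝒯, IsSpanningTree T X.graph) →
      S ⊆ 𝒯 → (𝒯 \ S).card ≤ k → X.birth q < m → (∀ T ∈ S, X.Uprooted T q M) → 𝒯.card ≤ μ →
      ¬ X.Desc q x → (∀ T ∈ S, need T = 0) → ∑ T ∈ 𝒯, need T ≤ j →
      (∀ T ∈ 𝒯, X.graph.dist x q + 4 ≤ T.dist x q + need T) → X.Defeats 𝒯 := by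
  induction j generalizing m with
  | zero =>
    refine ⟨m, le_rfl, fun X 𝒯 S x q need _ _ _ _ _ _ _ _ _ hsum hneed => ⟨x, q, fun T hT => ?_⟩⟩
    have h1 := hneed T hT
    have h2 := Finset.single_le_sum (f := need) (fun _ _ => Nat.zero_le _) hT
    omega
  | succ j ihj =>
    obtain ⟨M₁, hmM₁, hM₁⟩ := ih m
    obtain ⟨M, hMM, hM⟩ := ihj M₁
    refine ⟨M, by omega, fun {V N} X 𝒯 S x q need hN hST hS hk hq hU hμ hx hneedS hsum hneed => ?_⟩
    by_cases hall : ∀ T ∈ 𝒯, need T = 0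
    · refine ⟨x, q, fun T hT => ?_⟩
      have h1 := hneed T hT
      have h2 := hall T hT
      omega
    push Not at hall
    obtain ⟨T₀, hT₀, hpos⟩ := hall
    have hT₀S : T₀ ∉ S := fun h => hpos (hneedS T₀ h)
    by_cases hup : X.Uprooted T₀ q M₁
    · refine hM₁ X 𝒯 (insert T₀ S) q (by omega) hST (Finset.insert_subset hT₀ hS) ?_ hq ?_ hμ
      · refine (Finset.card_lt_card ?_).trans_le hk
        rw [Finset.ssubset_iff_of_subset (Finset.sdiff_subset_sdiff le_rfl (by simp))]
        exact ⟨T₀, by simp [hT₀, hT₀S], by simp⟩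
      · intro T hT
        rcases Finset.mem_insert.1 hT with rfl | hT
        · exact hup
        · exact (hU T hT).mono hMM
    · simp only [Uprooted, not_forall, not_le] at hup
      obtain ⟨b, hb, hbM, hbd⟩ := hup
      have hdG := X.connected.dist_triangle (u := x) (v := q) (w := b)
      -- Moving from `q` to `b` gains at least one for `T₀` and loses nothing for the other trees.
      refine hM X 𝒯 S x b (Function.update need T₀ (need T₀ - 1)) hN hST hS hk hbM
        (fun T hT => (hU T hT).desc (hST T (hS hT)).1 (hST T (hS hT)).2.1 hb) hμ
        (fun h => hx (hb.trans h)) ?_ ?_ ?_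
      · intro T hT
        rw [Function.update_of_ne (ne_of_mem_of_not_mem hT hT₀S)]
        exact hneedS T hT
      · rw [Finset.sum_update_of_mem hT₀]
        rw [← Finset.add_sum_erase _ _ hT₀, Finset.erase_eq] at hsum
        omega
      · intro T hT
        have h1 := hneed T hT
        have h2 := hb.dist_add_dist_le (hST T hT).1 (hST T hT).2.1 hx
        have h3 := SimpleGraph.Reachable.dist_anti (hST T hT).1 ((hST T hT).2.1.preconnected q b)
        by_cases hTT : T = T₀
        · subst hTT
          rw [Function.update_self]
          omega
        · rw [Function.update_of_ne hTT]
          omega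

open scoped Classical in
-- Induction on the number of trees not yet known to be uprooted. The bound `M` precedes the tower,
-- so one finite stage serves all systems of trees.
lemma exists_defeats (μ k m : ℕ) :
    ∃ M, m ≤ M ∧ ∀ {V : Type} {N : ℕ} (X : CliqueTower V N)
      (𝒯 S : Finset (SimpleGraph V)) (p : V), M ≤ N → (∀ T ∈ 𝒯, IsSpanningTree T X.graph) →
      S ⊆ 𝒯 → (𝒯 \ S).card < k → X.birth p < m → (∀ T ∈ S, X.Uprooted T p M) → 𝒯.card ≤ μ →
      X.Defeats 𝒯 := by
  induction k generalizing m with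
  | zero => exact ⟨m, le_rfl, fun X 𝒯 S p _ _ _ h => absurd h (Nat.not_lt_zero _)⟩
  | succ k ih =>
    -- With `h = 2` the branch distance is 6, enough for 1 + 4; one level lower it would only be 4.
    obtain ⟨M₁, hmM₁, hM₁⟩ := exists_clique_branches μ 2 m 2
    obtain ⟨M, hMM, hM⟩ := exists_defeats_of_excess k ih (μ * 5) M₁
    refine ⟨M, by omega, fun {V N} X 𝒯 S p hN hST hS hk hp hU hμ => ?_⟩
    obtain ⟨A, hA, hclique, hprop, hbr⟩ := hM₁ X p S (by omega) hp
      ((Finset.card_le_card hS).trans hμ) (fun T hT => hST T (hS hT))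
      (fun T hT => (hU T hT).mono hMM)
    obtain ⟨x, q, hxq, rfl⟩ := Finset.card_eq_two.1 hA
    obtain ⟨-, -, hxL, -⟩ := hprop x (by simp)
    obtain ⟨hqp, hqM, hqL, -⟩ := hprop q (by simp)
    have hd := SimpleGraph.dist_eq_one_iff_adj.2 (hclique (by simp) (by simp) hxq)
    -- As `x` and `q` are adjacent, a need of 5 = 1 + 4 covers any tree outside `S`.
    refine hM X 𝒯 S x q (fun T => if T ∈ S then 0 else 5) hN hST hS (by omega) hqM
      (fun T hT => (hU T hT).desc (hST T (hS hT)).1 (hST T (hS hT)).2.1 hqp) hμ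
      (fun h => by have := h.level_lt; omega) (fun T hT => if_pos hT) ?_ fun T hT => ?_
    · refine (Finset.sum_le_card_nsmul 𝒯 _ 5 fun T _ => by split_ifs <;> omega).trans ?_
      simpa using Nat.mul_le_mul_right 5 hμ
    · by_cases hTS : T ∈ S
      · obtain ⟨l, hl, hlA⟩ := hbr T hTS
        have h1 := le_dist_of_branches (hST T hT).1 (hST T hT).2 hxL hqL (hlA x (by simp)).1
          (hlA q (by simp)).1 (fun h => hxq (hl (by simp) (by simp) h)) (hlA x (by simp)).2
          (hlA q (by simp)).2
        omega
      · simp only [hTS, if_false]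
        omega

theorem exists_not_admits (μ : ℕ) : ∃ M, ∀ {V : Type} {N : ℕ} (X : CliqueTower V N),
    M ≤ N → ¬ AdmitsCollectiveTreeSpanners X.graph μ 3 := by
  obtain ⟨M, -, hM⟩ := exists_defeats μ (μ + 1) 1
  refine ⟨M, fun X hN => ?_⟩
  rintro ⟨𝒯, hcard, hST, hspan⟩
  obtain ⟨x, y, hxy⟩ := hM X 𝒯 ∅ X.root hN hST (by simp)
    (by simp only [Finset.sdiff_empty]; omega) (by simp [X.birth_root]) (by simp) hcard
  obtain ⟨T, hT, hle⟩ := hspan x y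
  have := hxy T hT
  omega

end CliqueTower
end CollectiveTreeSpanners
-- Chordality
namespace CollectiveTreeSpanners
namespace CliqueTower

/-- Both neighbours of the latest-born vertex of an induced cycle are among its parents, hence
adjacent, which gives a chord. -/
lemma isChordal {V : Type} {N : ℕ} (X : CliqueTower V N) : IsChordal X.graph := by
  rintro k hk ⟨f⟩
  obtain ⟨n, rfl⟩ : ∃ n, k = n + 2 + 2 := ⟨k - 4, by omega⟩
  obtain ⟨i, hi⟩ := Finite.exists_max fun i => X.birth (f i)
  have hmem : ∀ j, (SimpleGraph.cycleGraph (n + 2 + 2)).Adj i j → f j ∈ X.par (f i) :=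
    fun j hj => by
      rcases (X.adj_iff _ _).1 (f.map_rel_iff.2 hj) with h | h
      · exact absurd (X.birth_lt _ _ h) (hi j).not_gt
      · exact h
  have h1 : (1 : Fin (n + 2 + 2)) ≠ 0 := by simp
  have h2 : (1 : Fin (n + 2 + 2)) + 1 ≠ 0 := by
    simp [Fin.ext_iff, Fin.val_add, Nat.mod_eq_of_lt]
  have h3 : (1 : Fin (n + 2 + 2)) + 1 + 1 ≠ 0 := by
    simp [Fin.ext_iff, Fin.val_add, Nat.mod_eq_of_lt]
  have hadj := X.isClique_par (f i) (hmem (i + 1) (by simp [SimpleGraph.cycleGraph_adj]))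
    (hmem (i - 1) (by simp [SimpleGraph.cycleGraph_adj])) fun h => h2 <| by
      have h := f.injective h
      rw [← sub_eq_zero] at h
      rw [← h]
      abel
  rw [f.map_rel_iff, SimpleGraph.cycleGraph_adj] at hadj
  rcases hadj with h | h
  · refine h1 (add_left_cancel (a := 1) ?_)
    calc (1 : Fin (n + 2 + 2)) + 1 = i + 1 - (i - 1) := by abel
      _ = 1 + 0 := by rw [h, add_zero]
  · refine h3 ?_
    calc (1 : Fin (n + 2 + 2)) + 1 + 1 = i - 1 - (i + 1) + 1 + 1 := by rw [h]
      _ = 0 := by abel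

end CliqueTower

/-! ### Construction of the universal graph from binary digits -/

open scoped Classical in
/-- The clique to which the vertex `v` of the universal chordal graph is attached: the positions of
the binary digits `1` of `v` if these form a clique, and `{0}` otherwise. -/
noncomputable def bitParents (v : ℕ) : Finset ℕ :=
  if ∀ a b : {i // i ∈ v.bitIndices.toFinset}, a.1 < b.1 → a.1 ∈ bitParents b.1
  then v.bitIndices.toFinset else {0}
termination_by v
decreasing_by
  all_goals
    refine Nat.lt_two_pow_self.trans_le (Nat.two_pow_le_of_mem_bitIndices (List.mem_toFinset.1 ?_))
    exact Subtype.prop _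

lemma lt_of_mem_bitParents {u v : ℕ} (h : u ∈ bitParents v) : u < v := by
  rw [bitParents] at h
  split_ifs at h with hc
  · exact Nat.lt_two_pow_self.trans_le (Nat.two_pow_le_of_mem_bitIndices (by simpa using h))
  · rw [Finset.mem_singleton] at h
    subst h
    -- For `v = 0` there are no digits, so the clique condition is vacuous and the fallback `{0}` is
    -- not used.
    rcases Nat.eq_zero_or_pos v with rfl | hv
    · simp at hc
    · exact hv

lemma bitParents_nonempty {v : ℕ} (hv : v ≠ 0) : (bitParents v).Nonempty := by
  rw [bitParents]
  split_ifs with hc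
  · rw [Finset.nonempty_iff_ne_empty]
    intro h
    have := Finset.sum_toFinset_bitIndices_two_pow v
    rw [h] at this
    exact hv (by simpa using this.symm)
  · simp

lemma mem_bitParents_of_lt {v a b : ℕ} (ha : a ∈ bitParents v) (hb : b ∈ bitParents v)
    (hab : a < b) : a ∈ bitParents b := by
  rw [bitParents] at ha hb
  split_ifs at ha hb with hc
  · exact hc ⟨a, ha⟩ ⟨b, hb⟩ hab
  · simp at ha hb
    omega

lemma exists_bitParents_eq (m : ℕ) (Q : Finset ℕ)
    (hQ : ∀ a ∈ Q, ∀ b ∈ Q, a < b → a ∈ bitParents b) (hm : ∀ a ∈ Q, a < m) :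
    ∃ v, bitParents v = Q ∧ v < 2 ^ m := by
  refine ⟨∑ i ∈ Q, 2 ^ i, ?_, Nat.geomSum_lt le_rfl hm⟩
  rw [bitParents, Finset.toFinset_bitIndices_sum_two_pow]
  rw [if_pos]
  exact fun a b => hQ a.1 a.2 b.1 b.2

/-- The distance of `v` to the root `0` in the universal chordal graph. -/
noncomputable def bitLevel (v : ℕ) : ℕ :=
  -- The infimum over the empty family is 0, the level of the root.
  ⨅ u : {u // u ∈ bitParents v}, (bitLevel u.1 + 1)
termination_by v
decreasing_by exact lt_of_mem_bitParents u.2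

lemma exists_bitLevel {v : ℕ} (h : (bitParents v).Nonempty) :
    ∃ u ∈ bitParents v, bitLevel v = bitLevel u + 1 := by
  have : Nonempty {u // u ∈ bitParents v} := h.to_subtype
  obtain ⟨u, hu⟩ := Nat.sInf_mem
    (Set.range_nonempty fun u : {u // u ∈ bitParents v} => bitLevel u.1 + 1)
  exact ⟨u.1, u.2, by rw [bitLevel]; exact hu.symm⟩

lemma bitLevel_le {u v : ℕ} (h : u ∈ bitParents v) : bitLevel v ≤ bitLevel u + 1 := by
  rw [bitLevel]
  exact ciInf_le (OrderBot.bddBelow _) (⟨u, h⟩ : {u // u ∈ bitParents v})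

/-- The finite stages of the universal chordal graph. -/
def bitGraph (N : ℕ) : SimpleGraph (Fin N) where
  Adj u v := u.1 ∈ bitParents v.1 ∨ v.1 ∈ bitParents u.1
  symm := ⟨fun _ _ h => h.symm⟩
  loopless := ⟨fun _ h => (lt_of_mem_bitParents (h.elim id id)).false⟩

lemma bitGraph_connected (N : ℕ) : (bitGraph (N + 1)).Connected := by
  have h0 : ∀ (n : ℕ) (hn : n < N + 1), (bitGraph (N + 1)).Reachable ⟨n, hn⟩ 0 := by
    intro n
    induction n using Nat.strong_induction_on with
    | _ n ih =>
      intro hn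
      by_cases h : n = 0
      · subst h; exact .refl _
      · obtain ⟨u, hu⟩ := bitParents_nonempty h
        have hlt := lt_of_mem_bitParents hu
        have hadj : (bitGraph (N + 1)).Adj ⟨n, hn⟩ ⟨u, hlt.trans hn⟩ := Or.inr hu
        exact hadj.reachable.trans (ih u hlt _)
  exact ⟨fun u v => (h0 u.1 u.2).trans (h0 v.1 v.2).symm⟩

open scoped Classical in
noncomputable def bitTower (N : ℕ) : CliqueTower (Fin (N + 1)) (N + 1) where
  graph := bitGraph (N + 1)
  par v := Finset.univ.filter fun u => u.1 ∈ bitParents v.1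
  birth v := v.1
  level v := bitLevel v.1
  root := 0
  birth_root := rfl
  connected := bitGraph_connected N
  adj_iff u v := by simp [bitGraph]
  birth_lt u v h := lt_of_mem_bitParents (by simpa using h)
  isClique_par v a ha b hb hab := by
    have ha : a.1 ∈ bitParents v.1 := by simpa using ha
    have hb : b.1 ∈ bitParents v.1 := by simpa using hb
    rcases lt_or_gt_of_ne (Fin.val_ne_of_ne hab) with h | h
    · exact Or.inl (mem_bitParents_of_lt ha hb h)
    · exact Or.inr (mem_bitParents_of_lt hb ha h)
  exists_level v h := by
    obtain ⟨w, hw⟩ := h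
    obtain ⟨u, hu, hL⟩ := exists_bitLevel (v := v.1) ⟨w.1, by simpa using hw⟩
    exact ⟨⟨u, (lt_of_mem_bitParents hu).trans v.2⟩, by simpa using hu, hL⟩
  level_le u v h := bitLevel_le (by simpa using h)
  exists_par m Q _ hQ hm hN := by
    obtain ⟨v, hv, hvm⟩ := exists_bitParents_eq m (Q.map Fin.valEmbedding) (by
        simp only [Finset.mem_map, Fin.valEmbedding_apply]
        rintro _ ⟨a, ha, rfl⟩ _ ⟨b, hb, rfl⟩ hab
        refine (hQ ha hb (fun h => hab.ne (congrArg Fin.val h))).resolve_right fun h => ?_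
        exact (lt_of_mem_bitParents h).not_gt hab) (by
        simpa using hm)
    refine ⟨⟨v, by omega⟩, ?_, hvm⟩
    ext u
    simp [hv, Fin.val_inj]

end CollectiveTreeSpanners

theorem mainTheorem5 :
    ∀ μ : ℕ, ∃ (n : ℕ) (G : SimpleGraph (Fin n)),
      G.Connected ∧ CollectiveTreeSpanners.IsChordal G ∧
        ¬ CollectiveTreeSpanners.AdmitsCollectiveTreeSpanners G μ 3 := by
  intro μ
  obtain ⟨M, hM⟩ := CollectiveTreeSpanners.CliqueTower.exists_not_admits μ
  exact ⟨M + 1, _, (CollectiveTreeSpanners.bitTower M).connected,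
    (CollectiveTreeSpanners.bitTower M).isChordal, hM (CollectiveTreeSpanners.bitTower M) (Nat.le_succ M)⟩
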